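/- Let $0<q<1$, write $(x;p)_k=\prod_{i=0}^{k-1}(1-xp^i)$ for $k\in\mathbb Z_{\ge 0}\cup\{\infty\}$, $(x_1,\dots,x_r;p)_k=\prod_{j}(x_j;p)_k$, and $${}_{r+1}\varphi_r\left(\genfrac{}{}{0pt}{}{a_1,\dots,a_{r+1}}{b_1,\dots,b_r};p,x\right)=\sum_{k=0}^\infty\frac{(a_1,\dots,a_{r+1};p)_k}{(b_1,\dots,b_r,p;p)_k}\,x^k .$$ Let $a,y,z\in\mathbb C$ satisfy $|z|<\min(1,|a|^2)$ (so $a\neq0$) and $y^2\notin\{q^{-1},q^{-2},\dots\}$. Then the ${}_2\varphi_1$-series below converges absolutely, $(-z/a^2;q)_\infty\neq0$, and $${}_2\varphi_1\left(\genfrac{}{}{0pt}{}{ay,-ay}{qy^2};q,-\frac{z}{a^2}\right)=\frac{(z,\,qzy^2/a^2;q^2)_\infty}{(-z/a^2;q)_\infty}\;{}_3\varphi_2\left(\genfrac{}{}{0pt}{}{q^2y^2/a^2,\,-y^2,\,-qy^2}{qzy^2/a^2,\;q^2y^4};q^2,z\right)$$ whenever the ${}_3\varphi_2$-series is defined, that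 is, whenever neither of its lower parameters $qzy^2/a^2$, $q^2y^4$ lies in $\{1,q^{-2},q^{-4},\dots\}$; the ${}_3\varphi_2$-series then converges absolutely. At the remaining values of $y$ the identity holds with the right-hand side understood by continuity in $y$: for every $y$ with $y^2\notin\{q^{-1},q^{-2},\dots\}$, the right-hand side at $w$ tends to the left-hand side at $y$ as $w\to y$, $w\ne y$. -/

import Mathlib

open Filter Topology

noncomputable section

/-- The finite `q`-shifted factorial `(a;q)_k = ∏_{i=0}^{k-1} (1 - a q^i)`. -/
def qPoch (a q : ℂ) (k : ℕ) : ℂ := ∏ i ∈ Finset.range k, (1 - a * q ^ i)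

/-- The infinite `q`-shifted factorial `(a;q)_∞ = ∏_{i=0}^∞ (1 - a q^i)`, for `|q| < 1`. -/
def qPochInf (a q : ℂ) : ℂ := ∏' i : ℕ, (1 - a * q ^ i)

/-- The infinite product defining `(a;q)_∞` converges for `|q| < 1`. -/
theorem multipliable_qPochInf (a : ℂ) {q : ℂ} (hq : ‖q‖ < 1) :
    Multipliable fun i : ℕ => 1 - a * q ^ i := by
  have h : Summable fun i : ℕ => -(a * q ^ i) :=
    ((summable_geometric_of_norm_lt_one hq).mul_left a).neg
  simpa [sub_eq_add_neg] using Complex.multipliable_one_add_of_summable h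

/-- The `k`-th term `(a_1,…,a_r;q)_k / (b_1,…,b_s,q;q)_k * z^k` of a basic hypergeometric
series with `r = s + 1`. -/
def qHypTerm (as bs : List ℂ) (q z : ℂ) (k : ℕ) : ℂ :=
  (as.map fun a => qPoch a q k).prod / ((bs.map fun b => qPoch b q k).prod * qPoch q q k) * z ^ k

/-- The basic hypergeometric series `_{r+1}φ_r(as; bs; q, z)`, where `as` has one entry more
than `bs`. -/
def qHyp (as bs : List ℂ) (q z : ℂ) : ℂ := ∑' k : ℕ, qHypTerm as bs q z k

/-- The left-hand side `₂φ₁(ay, -ay; qy²; q, -z/a²)`. -/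
def quadLHS (q a z y : ℂ) : ℂ :=
  qHyp [a * y, -(a * y)] [q * y ^ 2] q (-z / a ^ 2)

/-- The right-hand side
`(z, qzy²/a²; q²)_∞ / (-z/a²; q)_∞ * ₃φ₂(q²y²/a², -y², -qy²; qzy²/a², q²y⁴; q², z)`. -/
def quadRHS (q a z y : ℂ) : ℂ :=
  qPochInf z (q ^ 2) * qPochInf (q * z * y ^ 2 / a ^ 2) (q ^ 2) / qPochInf (-z / a ^ 2) q *
    qHyp [q ^ 2 * y ^ 2 / a ^ 2, -y ^ 2, -(q * y ^ 2)]
      [q * z * y ^ 2 / a ^ 2, q ^ 2 * y ^ 4] (q ^ 2) z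

end

theorem qPoch_succ (a q : ℂ) (k : ℕ) : qPoch a q (k + 1) = qPoch a q k * (1 - a * q ^ k) :=
  Finset.prod_range_succ _ _

@[simp] theorem qPoch_zero (a q : ℂ) : qPoch a q 0 = 1 := by simp [qPoch]

theorem qPochInf_eq_qPoch_mul (a : ℂ) {q : ℂ} (hq : ‖q‖ < 1) (k : ℕ) :
    qPochInf a q = qPoch a q k * qPochInf (a * q ^ k) q := by
  have hterm : ∀ i : ℕ, 1 - a * q ^ k * q ^ i = 1 - a * q ^ (i + k) := fun i => by ring
  have h : Multipliable fun i : ℕ => 1 - a * q ^ (i + k) :=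
    (multipliable_qPochInf (a * q ^ k) hq).congr hterm
  have h2 := Multipliable.prod_mul_tprod_nat_mul' (f := fun i : ℕ => 1 - a * q ^ i) h
  simp only [qPochInf, qPoch, hterm]
  exact h2.symm

theorem qPochInf_eq_one_sub_mul (a : ℂ) {q : ℂ} (hq : ‖q‖ < 1) :
    qPochInf a q = (1 - a) * qPochInf (a * q) q := by
  simpa [qPoch] using qPochInf_eq_qPoch_mul a hq 1

@[simp] theorem qPochInf_zero (q : ℂ) : qPochInf 0 q = 1 := by simp [qPochInf]

theorem qPochInf_ne_zero_iff (a : ℂ) {q : ℂ} (hq : ‖q‖ < 1) :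
    qPochInf a q ≠ 0 ↔ ∀ n : ℕ, a * q ^ n ≠ 1 := by
  constructor
  · intro h n hn
    apply h
    rw [qPochInf_eq_qPoch_mul a hq (n + 1), qPoch_succ, hn]
    simp
  · intro h
    have hs : Summable fun i : ℕ => ‖-(a * q ^ i)‖ := by
      simpa using ((summable_geometric_of_lt_one (norm_nonneg _) hq).mul_left ‖a‖)
    have := tprod_one_add_ne_zero_of_summable (f := fun i : ℕ => -(a * q ^ i))
      (fun i => by rw [← sub_eq_add_neg, sub_ne_zero]; exact (h i).symm) hs
    simpa [qPochInf, sub_eq_add_neg] using this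

theorem qPoch_ne_zero {a q : ℂ} (h : ∀ n : ℕ, a * q ^ n ≠ 1) (k : ℕ) : qPoch a q k ≠ 0 :=
  Finset.prod_ne_zero_iff.2 fun i _ => sub_ne_zero.2 (h i).symm

theorem mul_pow_ne_one_of_norm_lt_one {a q : ℂ} (ha : ‖a‖ < 1) (hq : ‖q‖ < 1) (n : ℕ) :
    a * q ^ n ≠ 1 := by
  intro h
  have h1 : ‖a * q ^ n‖ < 1 := by
    rw [norm_mul, norm_pow]
    exact (mul_le_of_le_one_right (norm_nonneg _)
      (pow_le_one₀ (norm_nonneg _) hq.le)).trans_lt ha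
  simp [h] at h1

theorem differentiable_qPochInf {q : ℂ} (hq : ‖q‖ < 1) :
    Differentiable ℂ fun u => qPochInf u q := by
  intro u
  have hs : Summable fun i : ℕ => (‖u‖ + 1) * ‖q‖ ^ i :=
    (summable_geometric_of_lt_one (norm_nonneg _) hq).mul_left _
  have hP := Summable.hasProdLocallyUniformlyOn_nat_one_add
    (f := fun (i : ℕ) (v : ℂ) => -(v * q ^ i)) (K := Metric.ball (0 : ℂ) (‖u‖ + 1))
    Metric.isOpen_ball hs (.of_forall fun n v hv => by
      rw [mem_ball_zero_iff] at hv
      rw [norm_neg, norm_mul, norm_pow]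
      gcongr) (fun n => by fun_prop)
  have hd := hP.differentiableOn
    (.of_forall fun s => by
      simpa [Finset.prod_fn] using DifferentiableOn.finsetProd (fun _ _ => by fun_prop))
    Metric.isOpen_ball
  have := hd.differentiableAt (x := u) (Metric.isOpen_ball.mem_nhds (by simp))
  simpa [qPochInf, sub_eq_add_neg] using this

theorem summable_of_ratio_tendsto {f ρ : ℕ → ℂ} {L : ℂ} (hL : ‖L‖ < 1)
    (hf : ∀ k, f (k + 1) = f k * ρ k) (hρ : Tendsto ρ atTop (𝓝 L)) : Summable f := by
  obtain ⟨r, hr, hr1⟩ := exists_between hL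
  refine summable_of_ratio_norm_eventually_le hr1 ?_
  filter_upwards [hρ.norm.eventually_lt_const hr] with k hk
  rw [hf, norm_mul, mul_comm]
  gcongr

theorem qHypTerm_succ (as bs : List ℂ) (q z : ℂ) (k : ℕ) :
    qHypTerm as bs q z (k + 1) = qHypTerm as bs q z k *
      ((as.map fun a => 1 - a * q ^ k).prod /
        ((bs.map fun b => 1 - b * q ^ k).prod * (1 - q * q ^ k)) * z) := by
  simp only [qHypTerm, qPoch_succ, List.prod_map_mul, pow_succ, div_eq_mul_inv, mul_inv]
  ring

@[simp] theorem qHypTerm_zero (as bs : List ℂ) (q z : ℂ) : qHypTerm as bs q z 0 = 1 := by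
  simp [qHypTerm]

theorem qHypTerm_mul_pow (as bs : List ℂ) (q u v : ℂ) (k : ℕ) :
    qHypTerm as bs q (u * v) k = qHypTerm as bs q u k * v ^ k := by
  simp only [qHypTerm, mul_pow]
  ring

theorem tendsto_one_sub_mul_pow (a : ℂ) {q : ℂ} (hq : ‖q‖ < 1) :
    Tendsto (fun k : ℕ => 1 - a * q ^ k) atTop (𝓝 1) := by
  simpa using ((tendsto_pow_atTop_nhds_zero_of_norm_lt_one hq).const_mul a).const_sub 1

theorem tendsto_list_prod_one_sub_mul_pow (l : List ℂ) {q : ℂ} (hq : ‖q‖ < 1) :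
    Tendsto (fun k : ℕ => (l.map fun a => 1 - a * q ^ k).prod) atTop (𝓝 1) := by
  induction l with
  | nil => simp
  | cons a l ih => simpa using (tendsto_one_sub_mul_pow a hq).mul ih

theorem summable_qHypTerm (as bs : List ℂ) {q z : ℂ} (hq : ‖q‖ < 1) (hz : ‖z‖ < 1) :
    Summable (qHypTerm as bs q z) := by
  refine summable_of_ratio_tendsto hz (qHypTerm_succ as bs q z) ?_
  simpa using ((tendsto_list_prod_one_sub_mul_pow as hq).div
    ((tendsto_list_prod_one_sub_mul_pow bs hq).mul (tendsto_one_sub_mul_pow q hq))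
    (by simp)).mul_const z

theorem tsum_sub_succ_eq {t G : ℕ → ℂ} (ht : Summable t) (h : ∀ k, t k = G k - G (k + 1))
    (hG : Tendsto G atTop (𝓝 0)) : ∑' k, t k = G 0 := by
  refine tendsto_nhds_unique ht.hasSum.tendsto_sum_nat ?_
  simp only [h, Finset.sum_range_sub']
  simpa using hG.const_sub (G 0)

theorem exists_summable_bound_of_ratio {α : Type*} [TopologicalSpace α] {f : ℕ → α → ℂ}
    {S : Set α} (hS : IsCompact S) (hf : ∀ k, ContinuousOn (f k) S) {r : ℝ} (hr0 : 0 ≤ r)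
    (hr1 : r < 1) (h : ∀ᶠ k in atTop, ∀ w ∈ S, ‖f (k + 1) w‖ ≤ r * ‖f k w‖) :
    ∃ u : ℕ → ℝ, Summable u ∧ ∀ k, ∀ w ∈ S, ‖f k w‖ ≤ u k := by
  rcases S.eq_empty_or_nonempty with rfl | hne
  · exact ⟨0, summable_zero, by simp⟩
  choose w hw hmax using fun k => hS.exists_isMaxOn hne (hf k).norm
  refine ⟨fun k => ‖f k (w k)‖, summable_of_ratio_norm_eventually_le hr1 ?_,
    fun k v hv => hmax k hv⟩
  filter_upwards [h] with k hk
  rw [norm_norm, norm_norm]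
  exact (hk _ (hw _)).trans (mul_le_mul_of_nonneg_left (hmax k (hw _)) hr0)

theorem eq_zero_of_qDifference {D β γ : ℂ → ℂ} {p : ℂ} {s : ℝ} (hs : 0 < s)
    (hD : DifferentiableOn ℂ D (Metric.ball 0 s)) (hβ : ContinuousAt β 0)
    (hγ : ContinuousAt γ 0) (hD0 : D 0 = 0)
    (heq : ∀ x ∈ Metric.ball (0 : ℂ) s, D x + β x * D (p * x) + γ x * D (p ^ 2 * x) = 0)
    (hne : ∀ n : ℕ, 1 + β 0 * p ^ (n + 1) + γ 0 * (p ^ 2) ^ (n + 1) ≠ 0) :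
    ∀ x ∈ Metric.ball (0 : ℂ) s, D x = 0 := by
  have h0 : (0 : ℂ) ∈ Metric.ball (0 : ℂ) s := Metric.mem_ball_self hs
  have han : AnalyticOnNhd ℂ D (Metric.ball 0 s) := hD.analyticOnNhd Metric.isOpen_ball
  suffices h : ∀ᶠ x in 𝓝 (0 : ℂ), D x = 0 from
    han.eqOn_zero_of_preconnected_of_eventuallyEq_zero
      (convex_ball 0 s).isPreconnected h0 h
  by_contra hcon
  obtain ⟨n, g, hg, hg0, hDg⟩ := (han 0 h0).exists_eventuallyEq_pow_smul_nonzero_iff.2 hcon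
  simp only [sub_zero, smul_eq_mul] at hDg
  obtain ⟨m, rfl⟩ : ∃ m, n = m + 1 := by
    refine Nat.exists_eq_succ_of_ne_zero ?_
    rintro rfl
    have := hDg.self_of_nhds
    simp [hD0] at this
    exact hg0 this.symm
  have hmul : ∀ c : ℂ, Tendsto (fun x : ℂ => c * x) (𝓝 0) (𝓝 0) := fun c => by
    simpa using (continuous_const_mul c).tendsto 0
  have hev : ∀ᶠ x in 𝓝[≠] (0 : ℂ), g x + β x * p ^ (m + 1) * g (p * x) +
      γ x * (p ^ 2) ^ (m + 1) * g (p ^ 2 * x) = 0 := by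
    have hall := hDg.and (((hmul p).eventually hDg).and (((hmul (p ^ 2)).eventually hDg).and
      (Metric.ball_mem_nhds (0 : ℂ) hs)))
    filter_upwards [nhdsWithin_le_nhds hall, self_mem_nhdsWithin] with x ⟨h1, h2, h3, hx⟩ hx0
    have h := heq x hx
    rw [h1, h2, h3] at h
    refine eq_zero_of_ne_zero_of_mul_left_eq_zero (pow_ne_zero (m + 1) hx0) ?_
    rw [← h]
    ring
  have hgc := hg.continuousAt
  have hlim : Tendsto (fun x => g x + β x * p ^ (m + 1) * g (p * x) +
      γ x * (p ^ 2) ^ (m + 1) * g (p ^ 2 * x)) (𝓝 0)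
      (𝓝 (g 0 + β 0 * p ^ (m + 1) * g 0 + γ 0 * (p ^ 2) ^ (m + 1) * g 0)) :=
    (hgc.tendsto.add ((hβ.tendsto.mul_const _).mul (hgc.tendsto.comp (hmul p)))).add
      ((hγ.tendsto.mul_const _).mul (hgc.tendsto.comp (hmul (p ^ 2))))
  have h := tendsto_nhds_unique (hlim.mono_left nhdsWithin_le_nhds)
    ((tendsto_congr' hev).2 tendsto_const_nhds)
  refine hne m (eq_zero_of_ne_zero_of_mul_right_eq_zero hg0 ?_)
  linear_combination h

theorem Summable.mul_pow_left {f : ℕ → ℂ} (hf : Summable f) {q : ℂ} (hq : ‖q‖ < 1) :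
    Summable fun k => q ^ k * f k := by
  refine .of_norm_bounded hf.norm fun k => ?_
  rw [norm_mul, norm_pow]
  exact mul_le_of_le_one_left (norm_nonneg _) (pow_le_one₀ (norm_nonneg _) hq.le)

theorem norm_sq_lt_one {q : ℂ} (hq : ‖q‖ < 1) : ‖q ^ 2‖ < 1 := by
  rw [norm_pow]
  exact pow_lt_one₀ (norm_nonneg _) hq two_ne_zero

theorem tsum_qDifference {q A Y x : ℂ} (hq : ‖q‖ < 1) {c : ℕ → ℂ}
    (hc : ∀ k, c (k + 1) * ((1 - q * q ^ k) * (1 - q * Y * q ^ k)) =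
      c k * (1 - A * Y * (q ^ 2) ^ k))
    (hs : Summable fun k => c k * x ^ k) :
    (1 - x) * ∑' k, c k * x ^ k - (1 + Y) * ∑' k, c k * (q * x) ^ k +
      Y * (1 + A * x) * ∑' k, c k * (q ^ 2 * x) ^ k = 0 := by
  have hs1 : Summable fun k => c k * (q * x) ^ k :=
    (hs.mul_pow_left hq).congr fun k => by ring
  have hs2 : Summable fun k => c k * (q ^ 2 * x) ^ k :=
    (hs.mul_pow_left (norm_sq_lt_one hq)).congr fun k => by ring
  have hsum := ((hs.mul_left (1 - x)).sub (hs1.mul_left (1 + Y))).add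
    (hs2.mul_left (Y * (1 + A * x)))
  rw [← tsum_mul_left, ← tsum_mul_left, ← tsum_mul_left,
    ← (hs.mul_left (1 - x)).tsum_sub (hs1.mul_left (1 + Y)),
    ← ((hs.mul_left (1 - x)).sub (hs1.mul_left (1 + Y))).tsum_add
      (hs2.mul_left (Y * (1 + A * x)))]
  rw [tsum_sub_succ_eq (G := fun k => (1 - 1 * q ^ k) * (1 - Y * q ^ k) * (c k * x ^ k)) hsum]
  · simp
  · intro k
    have h := hc k
    simp only [mul_pow, pow_succ]
    linear_combination (x ^ k * x) * h
  · simpa using ((tendsto_one_sub_mul_pow 1 hq).mul (tendsto_one_sub_mul_pow Y hq)).mul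
      hs.tendsto_atTop_zero

theorem qPochInf_mul_tsum_qDifference {q A Y x : ℂ} (hq : ‖q‖ < 1) {c : ℕ → ℂ}
    (hc : ∀ k, c (k + 1) * ((1 - q * q ^ k) * (1 - q * Y * q ^ k)) =
      c k * (1 - A * Y * (q ^ 2) ^ k))
    (hs : Summable fun k => c k * x ^ k) :
    qPochInf x q * ∑' k, c k * x ^ k -
      (1 + Y) * (qPochInf (q * x) q * ∑' k, c k * (q * x) ^ k) +
      Y * (1 + A * x) * (1 - q * x) *
        (qPochInf (q ^ 2 * x) q * ∑' k, c k * (q ^ 2 * x) ^ k) = 0 := by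
  have h := tsum_qDifference hq hc hs
  have e1 := qPochInf_eq_one_sub_mul x hq
  have e2 := qPochInf_eq_one_sub_mul (q * x) hq
  rw [show q * x * q = q ^ 2 * x by ring] at e2
  rw [mul_comm x q] at e1
  rw [e1, e2]
  linear_combination (1 - q * x) * qPochInf (q ^ 2 * x) q * h

theorem qPochInf_mul_tsum_sq_qDifference {q A Y x : ℂ} (hq : ‖q‖ < 1) {c : ℕ → ℂ}
    (hc : ∀ k, c (k + 1) * ((1 - q * q ^ k) * (1 - q * Y * q ^ k)) =
      c k * (1 - A * Y * (q ^ 2) ^ k))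
    (hs : Summable fun k => c k * x ^ k) :
    qPochInf x q * ∑' k, c k * x ^ k +
      (Y * (1 + A * x) * (1 - q * x) + Y * (1 + A * (q * x)) * (1 - q * (q * x)) -
        (1 + Y) ^ 2) * (qPochInf (q ^ 2 * x) q * ∑' k, c k * (q ^ 2 * x) ^ k) +
      Y ^ 2 * ((1 + A * (q * x)) * (1 - q * (q * x))) *
        ((1 + A * (q ^ 2 * x)) * (1 - q * (q ^ 2 * x))) *
        (qPochInf ((q ^ 2) ^ 2 * x) q * ∑' k, c k * ((q ^ 2) ^ 2 * x) ^ k) = 0 := by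
  have hs1 : Summable fun k => c k * (q * x) ^ k :=
    (hs.mul_pow_left hq).congr fun k => by ring
  have hs2 : Summable fun k => c k * (q ^ 2 * x) ^ k :=
    (hs.mul_pow_left (norm_sq_lt_one hq)).congr fun k => by ring
  have h0 := qPochInf_mul_tsum_qDifference hq hc hs
  have h1 := qPochInf_mul_tsum_qDifference hq hc hs1
  have h2 := qPochInf_mul_tsum_qDifference hq hc hs2
  rw [show q * (q * x) = q ^ 2 * x by ring, show q ^ 2 * (q * x) = q ^ 3 * x by ring] at h1
  rw [show q * (q ^ 2 * x) = q ^ 3 * x by ring,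
    show q ^ 2 * (q ^ 2 * x) = (q ^ 2) ^ 2 * x by ring] at h2
  rw [show q * (q * x) = q ^ 2 * x by ring, show q * (q ^ 2 * x) = q ^ 3 * x by ring]
  linear_combination h0 + (1 + Y) * h1 + Y * (1 + A * (q * x)) * (1 - q ^ 2 * x) * h2

theorem exists_bound_qPochInf_mul_pow (u : ℂ) {p : ℂ} (hp : ‖p‖ < 1) (s : ℝ) :
    ∃ C : ℝ, ∀ x : ℂ, ‖x‖ ≤ s → ∀ k : ℕ, ‖qPochInf (u * x * p ^ k) p‖ ≤ C := by
  obtain ⟨C, hC⟩ := (isCompact_closedBall (0 : ℂ) (‖u‖ * s)).exists_bound_of_continuousOn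
    (differentiable_qPochInf hp).continuous.continuousOn
  refine ⟨C, fun x hx k => hC _ ?_⟩
  rw [mem_closedBall_zero_iff, norm_mul, norm_mul, norm_pow]
  exact (mul_le_of_le_one_right (by positivity) (pow_le_one₀ (norm_nonneg _) hp.le)).trans
    (by gcongr)

theorem norm_mul_pow_mul_qPochInf_le {d : ℕ → ℂ} {u p : ℂ} {s C : ℝ}
    (hC : ∀ x : ℂ, ‖x‖ ≤ s → ∀ k : ℕ, ‖qPochInf (u * x * p ^ k) p‖ ≤ C) {x : ℂ}
    (hx : ‖x‖ ≤ s) (k : ℕ) :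
    ‖d k * x ^ k * qPochInf (u * x * p ^ k) p‖ ≤ C * (‖d k‖ * s ^ k) := by
  rw [norm_mul, norm_mul, norm_pow, mul_comm C]
  have hs : 0 ≤ s := (norm_nonneg x).trans hx
  have := hC x hx k
  gcongr

theorem summable_mul_pow_mul_qPochInf {d : ℕ → ℂ} (u : ℂ) {p x : ℂ} (hp : ‖p‖ < 1)
    (hs : Summable fun k => d k * x ^ k) :
    Summable fun k => d k * x ^ k * qPochInf (u * x * p ^ k) p := by
  obtain ⟨C, hC⟩ := exists_bound_qPochInf_mul_pow u hp ‖x‖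
  refine .of_norm_bounded (hs.norm.mul_left C) fun k => ?_
  simpa using norm_mul_pow_mul_qPochInf_le hC le_rfl k

theorem differentiableOn_tsum_mul_pow_mul_qPochInf {d : ℕ → ℂ} (u : ℂ) {p : ℂ} {s : ℝ}
    (hp : ‖p‖ < 1) (hs : Summable fun k => ‖d k‖ * s ^ k) :
    DifferentiableOn ℂ (fun x => ∑' k, d k * x ^ k * qPochInf (u * x * p ^ k) p)
      (Metric.ball 0 s) := by
  obtain ⟨C, hC⟩ := exists_bound_qPochInf_mul_pow u hp s
  refine Complex.differentiableOn_tsum_of_summable_norm (hs.mul_left C) (fun k => ?_)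
    Metric.isOpen_ball fun k x hx => ?_
  · have := (differentiable_qPochInf hp).comp (f := fun x : ℂ => u * x * p ^ k) (by fun_prop)
    exact (Differentiable.mul (by fun_prop) this).differentiableOn
  · exact norm_mul_pow_mul_qPochInf_le hC (mem_ball_zero_iff.1 hx).le k

theorem tsum_mul_qPochInf_qDifference {q A Y x : ℂ} (hq : ‖q‖ < 1) {d : ℕ → ℂ}
    (hd : ∀ k, d (k + 1) * ((1 - q ^ 2 * (q ^ 2) ^ k) * (1 - q ^ 2 * Y ^ 2 * (q ^ 2) ^ k)) =
      d k * ((q ^ 2 * Y * (q ^ 2) ^ k - A) * (1 + Y * (q ^ 2) ^ k) *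
        (1 + q * Y * (q ^ 2) ^ k)))
    {R : ℂ → ℂ} (hR : ∀ x, R x = qPochInf (-A * x) (q ^ 2) *
      ∑' k, d k * x ^ k * qPochInf (-(q * Y) * x * (q ^ 2) ^ k) (q ^ 2))
    (hs : Summable fun k => d k * x ^ k) :
    R x +
      (Y * (1 + A * x) * (1 - q * x) + Y * (1 + A * (q * x)) * (1 - q * (q * x)) -
        (1 + Y) ^ 2) * R (q ^ 2 * x) +
      Y ^ 2 * ((1 + A * (q * x)) * (1 - q * (q * x))) *
        ((1 + A * (q ^ 2 * x)) * (1 - q * (q ^ 2 * x))) * R ((q ^ 2) ^ 2 * x) = 0 := by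
  have hp := norm_sq_lt_one hq
  have hs1 : Summable fun k => d k * (q ^ 2 * x) ^ k :=
    (hs.mul_pow_left hp).congr fun k => by ring
  have hs2 : Summable fun k => d k * ((q ^ 2) ^ 2 * x) ^ k :=
    (hs.mul_pow_left (norm_sq_lt_one hp)).congr fun k => by ring
  have hP : ∀ u : ℂ, qPochInf u (q ^ 2) = (1 - u) * qPochInf (q ^ 2 * u) (q ^ 2) := fun u => by
    rw [mul_comm (q ^ 2) u]
    exact qPochInf_eq_one_sub_mul u hp
  have S0 := (summable_mul_pow_mul_qPochInf (-(q * Y)) hp hs).mul_left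
    (qPochInf (-A * x) (q ^ 2))
  have S1 := ((summable_mul_pow_mul_qPochInf (-(q * Y)) hp hs1).mul_left
    (qPochInf (-A * (q ^ 2 * x)) (q ^ 2))).mul_left
      (Y * (1 + A * x) * (1 - q * x) + Y * (1 + A * (q * x)) * (1 - q * (q * x)) -
        (1 + Y) ^ 2)
  have S2 := ((summable_mul_pow_mul_qPochInf (-(q * Y)) hp hs2).mul_left
    (qPochInf (-A * ((q ^ 2) ^ 2 * x)) (q ^ 2))).mul_left
      (Y ^ 2 * ((1 + A * (q * x)) * (1 - q * (q * x))) *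
        ((1 + A * (q ^ 2 * x)) * (1 - q * (q ^ 2 * x))))
  rw [hR, hR, hR, ← tsum_mul_left, ← tsum_mul_left, ← tsum_mul_left, ← tsum_mul_left,
    ← tsum_mul_left, ← S0.tsum_add S1, ← (S0.add S1).tsum_add S2]
  rw [tsum_sub_succ_eq (G := fun k => (1 + A * q ^ 2 * x) *
    ((1 - 1 * (q ^ 2) ^ k) * (1 - Y ^ 2 * (q ^ 2) ^ k)) *
      qPochInf (q ^ 2 * (q ^ 2 * (-A * x))) (q ^ 2) *
      (d k * x ^ k * qPochInf (-(q ^ 3 * Y) * x * (q ^ 2) ^ k) (q ^ 2))) ((S0.add S1).add S2)]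
  · simp
  · intro k
    have h := hd k
    set K := (q ^ 2) ^ k with hK
    have a0 := hP (-A * x)
    have a1 := hP (q ^ 2 * (-A * x))
    have b0 := hP (-(q * Y) * x * K)
    have b1 := hP (-(q ^ 3 * Y) * x * K)
    rw [show q ^ 2 * (-(q * Y) * x * K) = -(q ^ 3 * Y) * x * K by ring] at b0
    have e1 : ((q ^ 2) * x) ^ k = K * x ^ k := by rw [mul_pow]
    have e2 : ((q ^ 2) ^ 2 * x) ^ k = K ^ 2 * x ^ k := by
      rw [mul_pow, hK]; ring
    rw [e1, e2, show (q ^ 2) ^ (k + 1) = q ^ 2 * K by rw [pow_succ, mul_comm],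
      show -A * (q ^ 2 * x) = q ^ 2 * (-A * x) by ring,
      show -A * ((q ^ 2) ^ 2 * x) = q ^ 2 * (q ^ 2 * (-A * x)) by ring,
      show -(q * Y) * (q ^ 2 * x) * K = -(q ^ 3 * Y) * x * K by ring,
      show -(q * Y) * ((q ^ 2) ^ 2 * x) * K = q ^ 2 * (-(q ^ 3 * Y) * x * K) by ring,
      show -(q ^ 3 * Y) * x * (q ^ 2 * K) = q ^ 2 * (-(q ^ 3 * Y) * x * K) by ring,
      a0, a1, b0, b1, pow_succ x k]
    linear_combination (1 + A * q ^ 2 * x) * qPochInf (q ^ 2 * (q ^ 2 * (-A * x))) (q ^ 2) *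
      qPochInf (q ^ 2 * (-(q ^ 3 * Y) * x * K)) (q ^ 2) * x ^ k * x * h
  · have hG := (((tendsto_one_sub_mul_pow 1 hp).mul (tendsto_one_sub_mul_pow (Y ^ 2) hp)).mul
      (summable_mul_pow_mul_qPochInf (-(q ^ 3 * Y)) hp hs).tendsto_atTop_zero).const_mul
      ((1 + A * q ^ 2 * x) * qPochInf (q ^ 2 * (q ^ 2 * (-A * x))) (q ^ 2))
    rw [mul_zero, mul_zero] at hG
    exact hG.congr fun k => by ring

theorem qPochInf_mul_tsum_eq {q A Y x : ℂ} (hq : ‖q‖ < 1) {s : ℝ} (hxs : ‖x‖ < s)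
    (hY : ∀ n : ℕ, q ^ 2 * Y ^ 2 * (q ^ 2) ^ n ≠ 1) {c d : ℕ → ℂ}
    (hc0 : c 0 = 1) (hd0 : d 0 = 1)
    (hc : ∀ k, c (k + 1) * ((1 - q * q ^ k) * (1 - q * Y * q ^ k)) =
      c k * (1 - A * Y * (q ^ 2) ^ k))
    (hd : ∀ k, d (k + 1) * ((1 - q ^ 2 * (q ^ 2) ^ k) * (1 - q ^ 2 * Y ^ 2 * (q ^ 2) ^ k)) =
      d k * ((q ^ 2 * Y * (q ^ 2) ^ k - A) * (1 + Y * (q ^ 2) ^ k) *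
        (1 + q * Y * (q ^ 2) ^ k)))
    (hcs : Summable fun k => ‖c k‖ * s ^ k) (hds : Summable fun k => ‖d k‖ * s ^ k) :
    qPochInf x q * ∑' k, c k * x ^ k = qPochInf (-A * x) (q ^ 2) *
      ∑' k, d k * x ^ k * qPochInf (-(q * Y) * x * (q ^ 2) ^ k) (q ^ 2) := by
  have hp := norm_sq_lt_one hq
  have hs0 : 0 < s := (norm_nonneg x).trans_lt hxs
  have hsum : ∀ e : ℕ → ℂ, (Summable fun k => ‖e k‖ * s ^ k) → ∀ w ∈ Metric.ball (0 : ℂ) s,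
      Summable fun k => e k * w ^ k := fun e he w hw => by
    refine .of_norm_bounded he fun k => ?_
    rw [norm_mul, norm_pow]
    have := (mem_ball_zero_iff.1 hw).le
    gcongr
  have hval0 : ∀ e : ℕ → ℂ, (∑' k, e k * (0 : ℂ) ^ k) = e 0 := fun e => by
    rw [tsum_eq_single 0 fun k hk => by simp [hk]]
    simp
  set R : ℂ → ℂ := fun x => qPochInf (-A * x) (q ^ 2) *
    ∑' k, d k * x ^ k * qPochInf (-(q * Y) * x * (q ^ 2) ^ k) (q ^ 2) with hR
  set H : ℂ → ℂ := fun x => qPochInf x q * ∑' k, c k * x ^ k with hH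
  have hdR : DifferentiableOn ℂ R (Metric.ball 0 s) := by
    have h1 := (differentiable_qPochInf hp).comp (f := fun x : ℂ => -A * x) (by fun_prop)
    exact h1.differentiableOn.mul (differentiableOn_tsum_mul_pow_mul_qPochInf _ hp hds)
  have hdH : DifferentiableOn ℂ H (Metric.ball 0 s) := by
    refine (differentiable_qPochInf hq).differentiableOn.mul ?_
    simpa using differentiableOn_tsum_mul_pow_mul_qPochInf 0 hp hcs
  have h := eq_zero_of_qDifference (p := q ^ 2) (D := fun x => H x - R x)
    (β := fun x => Y * (1 + A * x) * (1 - q * x) + Y * (1 + A * (q * x)) * (1 - q * (q * x)) -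
        (1 + Y) ^ 2)
    (γ := fun x => Y ^ 2 * ((1 + A * (q * x)) * (1 - q * (q * x))) *
        ((1 + A * (q ^ 2 * x)) * (1 - q * (q ^ 2 * x)))) hs0 (hdH.sub hdR)
    (Continuous.continuousAt (by fun_prop)) (Continuous.continuousAt (by fun_prop)) ?_ ?_ ?_ x
    (mem_ball_zero_iff.2 hxs)
  · exact sub_eq_zero.1 h
  · have h1 := hval0 c
    have h2 := hval0 d
    simp only [hH, hR, mul_zero, zero_mul, qPochInf_zero, mul_one, h1, h2, hc0, hd0,
      sub_self]
  · intro w hw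
    have h1 := qPochInf_mul_tsum_sq_qDifference hq hc (hsum c hcs w hw)
    have h2 := tsum_mul_qPochInf_qDifference (R := R) hq hd (fun _ => rfl) (hsum d hds w hw)
    simp only [hH]
    linear_combination h1 - h2
  · intro n hn
    have h1 := mul_pow_ne_one_of_norm_lt_one hp hp n
    refine mul_ne_zero (sub_ne_zero.2 h1.symm) (sub_ne_zero.2 (hY n).symm) ?_
    rw [← hn]
    ring

theorem quad_identity {q a y x : ℂ} (hq : ‖q‖ < 1) (ha : a ≠ 0) (hx : ‖x‖ < 1)
    (hax : ‖a ^ 2 * x‖ < 1) (hy : ∀ n : ℕ, q * y ^ 2 * q ^ n ≠ 1)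
    (hy4 : ∀ n : ℕ, q ^ 2 * y ^ 4 * (q ^ 2) ^ n ≠ 1)
    (hB : ∀ n : ℕ, -(q * y ^ 2) * x * (q ^ 2) ^ n ≠ 1) :
    qPochInf x q * qHyp [a * y, -(a * y)] [q * y ^ 2] q x =
      qPochInf (-a ^ 2 * x) (q ^ 2) * (qPochInf (-(q * y ^ 2) * x) (q ^ 2) *
        qHyp [q ^ 2 * y ^ 2 / a ^ 2, -y ^ 2, -(q * y ^ 2)]
          [-(q * y ^ 2) * x, q ^ 2 * y ^ 4] (q ^ 2) (-a ^ 2 * x)) := by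
  have hp := norm_sq_lt_one hq
  have ha2 : 0 < ‖a ^ 2‖ := norm_pos_iff.2 (pow_ne_zero 2 ha)
  obtain ⟨s, hxs, hs⟩ := exists_between (lt_min hx ((lt_div_iff₀' ha2).2 (by rwa [← norm_mul])) :
    ‖x‖ < min 1 (1 / ‖a ^ 2‖))
  have hs0 : 0 ≤ s := (norm_nonneg x).trans hxs.le
  have hs1 : s < 1 := hs.trans_le (min_le_left _ _)
  have hs2 : ‖a ^ 2‖ * s < 1 := (lt_div_iff₀' ha2).1 (hs.trans_le (min_le_right _ _))
  have hsum : ∀ (as bs : List ℂ) (p u : ℂ), ‖p‖ < 1 → ‖u‖ * s < 1 →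
      Summable fun k => ‖qHypTerm as bs p u k‖ * s ^ k := fun as bs p u hp hu => by
    have h : ‖u * (s : ℂ)‖ < 1 := by rwa [norm_mul, Complex.norm_of_nonneg hs0]
    refine (summable_qHypTerm as bs hp h).norm.congr fun k => ?_
    rw [qHypTerm_mul_pow, norm_mul, norm_pow, Complex.norm_of_nonneg hs0]
  have key := qPochInf_mul_tsum_eq (q := q) (A := a ^ 2) (Y := y ^ 2) (x := x) (s := s)
    (c := qHypTerm [a * y, -(a * y)] [q * y ^ 2] q 1)
    (d := qHypTerm [q ^ 2 * y ^ 2 / a ^ 2, -y ^ 2, -(q * y ^ 2)] [q ^ 2 * y ^ 4] (q ^ 2)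
      (-a ^ 2)) hq hxs (fun n => by rw [← pow_mul]; exact hy4 n) (by simp) (by simp) ?_ ?_
    (hsum _ _ _ _ hq (by simpa)) (hsum _ _ _ _ hp (by simpa using hs2))
  · rw [qHyp, qHyp]
    have e1 : ∀ k, qHypTerm [a * y, -(a * y)] [q * y ^ 2] q x k =
        qHypTerm [a * y, -(a * y)] [q * y ^ 2] q 1 k * x ^ k := fun k => by
      rw [← qHypTerm_mul_pow, one_mul]
    rw [tsum_congr e1, key, ← tsum_mul_left (a := qPochInf (-(q * y ^ 2) * x) (q ^ 2))]
    congr 1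
    refine tsum_congr fun k => ?_
    rw [qHypTerm_mul_pow, qPochInf_eq_qPoch_mul (-(q * y ^ 2) * x) hp k]
    have hne := qPoch_ne_zero hB k
    generalize -(q * y ^ 2) * x = B at hne ⊢
    simp only [qHypTerm, List.map_cons, List.map_nil, List.prod_cons, List.prod_nil, mul_one]
    field_simp
  · intro k
    have h1 : 1 - q * q ^ k ≠ 0 :=
      sub_ne_zero.2 (mul_pow_ne_one_of_norm_lt_one hq hq k).symm
    have h2 : 1 - q * y ^ 2 * q ^ k ≠ 0 := sub_ne_zero.2 (hy k).symm
    rw [qHypTerm_succ]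
    simp only [List.map_cons, List.map_nil, List.prod_cons, List.prod_nil, mul_one]
    rw [mul_assoc, mul_comm (1 - q * q ^ k), div_mul_cancel₀ _ (mul_ne_zero h2 h1)]
    ring
  · intro k
    have h1 : 1 - q ^ 2 * (q ^ 2) ^ k ≠ 0 :=
      sub_ne_zero.2 (mul_pow_ne_one_of_norm_lt_one hp hp k).symm
    have h2 : 1 - q ^ 2 * y ^ 4 * (q ^ 2) ^ k ≠ 0 := sub_ne_zero.2 (hy4 k).symm
    rw [qHypTerm_succ, show q ^ 2 * (y ^ 2) ^ 2 * (q ^ 2) ^ k = q ^ 2 * y ^ 4 * (q ^ 2) ^ k by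
      ring]
    simp only [List.map_cons, List.map_nil, List.prod_cons, List.prod_nil, mul_one]
    field_simp
    ring

theorem quadLHS_eq_quadRHS {q a y z : ℂ} (hq : ‖q‖ < 1) (hz1 : ‖z‖ < 1) (hza : ‖z‖ < ‖a‖ ^ 2)
    (hy : ∀ n : ℕ, q * y ^ 2 * q ^ n ≠ 1)
    (hy4 : ∀ n : ℕ, q ^ 2 * y ^ 4 * (q ^ 2) ^ n ≠ 1)
    (hB : ∀ n : ℕ, q * z * y ^ 2 / a ^ 2 * (q ^ 2) ^ n ≠ 1) :
    quadLHS q a z y = quadRHS q a z y := by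
  have ha : a ≠ 0 := by
    rintro rfl
    simp at hza
    exact absurd hza (norm_nonneg z).not_gt
  have hx : ‖-z / a ^ 2‖ < 1 := by
    rw [norm_div, norm_neg, norm_pow]
    exact (div_lt_one ((norm_nonneg z).trans_lt hza)).2 hza
  have hx0 : qPochInf (-z / a ^ 2) q ≠ 0 :=
    (qPochInf_ne_zero_iff _ hq).2 (mul_pow_ne_one_of_norm_lt_one hx hq)
  have ez : -a ^ 2 * (-z / a ^ 2) = z := by field_simp
  have eB : -(q * y ^ 2) * (-z / a ^ 2) = q * z * y ^ 2 / a ^ 2 := by ring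
  have h := quad_identity hq ha hx (by rwa [← norm_neg, ← neg_mul, ez]) hy hy4 (by rwa [eB])
  rw [ez, eB] at h
  rw [quadLHS, quadRHS, div_mul_eq_mul_div, eq_div_iff hx0, mul_comm _ (qPochInf (-z / a ^ 2) q), h]
  exact (mul_assoc _ _ _).symm

theorem continuousAt_qHyp_param {q a x y : ℂ} (hq : ‖q‖ < 1) (hx : ‖x‖ < 1)
    (hy : ∀ n : ℕ, q * y ^ 2 * q ^ n ≠ 1) :
    ContinuousAt (fun w : ℂ => qHyp [a * w, -(a * w)] [q * w ^ 2] q x) y := by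
  have hP : Continuous fun w : ℂ => qPochInf (q * w ^ 2) q :=
    (differentiable_qPochInf hq).continuous.comp (by fun_prop)
  have hnhds : {w : ℂ | qPochInf (q * w ^ 2) q ≠ 0} ∈ 𝓝 y :=
    (isOpen_ne_fun hP continuous_const).mem_nhds ((qPochInf_ne_zero_iff _ hq).2 hy)
  obtain ⟨S, hS, hSsub, hSc⟩ := local_compact_nhds hnhds
  have hSy : ∀ w ∈ S, ∀ n : ℕ, q * w ^ 2 * q ^ n ≠ 1 := fun w hw =>
    (qPochInf_ne_zero_iff _ hq).1 (hSsub hw)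
  obtain ⟨r, hxr, hr1⟩ := exists_between hx
  have hcont : ∀ k, ContinuousOn
      (fun w : ℂ => qHypTerm [a * w, -(a * w)] [q * w ^ 2] q x k) S := fun k => by
    simp only [qHypTerm, List.map_cons, List.map_nil, List.prod_cons, List.prod_nil, mul_one]
    refine ContinuousOn.mul (ContinuousOn.div ?_ ?_ fun w hw => ?_) continuousOn_const
    · exact Continuous.continuousOn (by unfold qPoch; fun_prop)
    · exact Continuous.continuousOn (by unfold qPoch; fun_prop)
    · exact mul_ne_zero (qPoch_ne_zero (hSy w hw) k)
        (qPoch_ne_zero (mul_pow_ne_one_of_norm_lt_one hq hq) k)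
  have hratio : ∀ᶠ t in 𝓝 (0 : ℂ), ∀ w ∈ S,
      ‖(1 - a * w * t) * (1 - -(a * w) * t) / ((1 - q * w ^ 2 * t) * (1 - q * t)) * x‖ < r := by
    refine hSc.eventually_forall_of_forall_eventually fun w _ => ?_
    have hc : ContinuousAt (fun v : ℂ × ℂ => ‖(1 - a * v.2 * v.1) * (1 - -(a * v.2) * v.1) /
        ((1 - q * v.2 ^ 2 * v.1) * (1 - q * v.1)) * x‖) (0, w) := by
      refine ContinuousAt.norm (ContinuousAt.mul (ContinuousAt.div ?_ ?_ (by simp))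
        continuousAt_const)
      · exact Continuous.continuousAt (by fun_prop)
      · exact Continuous.continuousAt (by fun_prop)
    exact hc.eventually_lt_const (by simpa using hxr)
  obtain ⟨u, hu, hbound⟩ := exists_summable_bound_of_ratio hSc hcont
    ((norm_nonneg x).trans hxr.le) hr1 (by
      filter_upwards [(tendsto_pow_atTop_nhds_zero_of_norm_lt_one hq).eventually hratio]
        with k hk w hw
      rw [qHypTerm_succ, norm_mul, mul_comm]
      refine mul_le_mul_of_nonneg_right ?_ (norm_nonneg _)
      simpa using (hk w hw).le)
  exact (continuousOn_tsum hcont hu hbound).continuousAt hS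

theorem eventually_qPochInf_comp_ne_zero {p : ℂ} (hp : ‖p‖ < 1) {f : ℂ → ℂ}
    (hf : Differentiable ℂ f) (hf0 : f 0 = 0) (y : ℂ) :
    ∀ᶠ w in 𝓝[≠] y, ∀ n : ℕ, f w * p ^ n ≠ 1 := by
  have hg : AnalyticOnNhd ℂ (fun w => qPochInf (f w) p) Set.univ :=
    DifferentiableOn.analyticOnNhd
      ((differentiable_qPochInf hp).comp hf).differentiableOn isOpen_univ
  have h : ∀ᶠ w in 𝓝[≠] y, qPochInf (f w) p ≠ 0 := by
    refine (hg y (Set.mem_univ y)).eventually_eq_zero_or_eventually_ne_zero.resolve_left ?_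
    intro hz
    have := hg.eqOn_zero_of_preconnected_of_eventuallyEq_zero isPreconnected_univ
      (Set.mem_univ y) hz (Set.mem_univ 0)
    simp [hf0] at this
  filter_upwards [h] with w hw
  exact (qPochInf_ne_zero_iff _ hp).1 hw

theorem mainTheorem5 (q : ℝ) (hq0 : 0 < q) (hq1 : q < 1) (a y z : ℂ)
    (hz : ‖z‖ < min 1 (‖a‖ ^ 2))
    (hy : ∀ n : ℕ, (q : ℂ) * y ^ 2 * (q : ℂ) ^ n ≠ 1) :
    Summable (qHypTerm [a * y, -(a * y)] [(q : ℂ) * y ^ 2] (q : ℂ) (-z / a ^ 2)) ∧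
    qPochInf (-z / a ^ 2) (q : ℂ) ≠ 0 ∧
    ((∀ n : ℕ, (q : ℂ) * z * y ^ 2 / a ^ 2 * ((q : ℂ) ^ 2) ^ n ≠ 1) →
      (∀ n : ℕ, (q : ℂ) ^ 2 * y ^ 4 * ((q : ℂ) ^ 2) ^ n ≠ 1) →
      Summable (qHypTerm [(q : ℂ) ^ 2 * y ^ 2 / a ^ 2, -y ^ 2, -((q : ℂ) * y ^ 2)]
        [(q : ℂ) * z * y ^ 2 / a ^ 2, (q : ℂ) ^ 2 * y ^ 4] ((q : ℂ) ^ 2) z) ∧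
      quadLHS (q : ℂ) a z y = quadRHS (q : ℂ) a z y) ∧
    Tendsto (fun w : ℂ => quadRHS (q : ℂ) a z w) (𝓝[≠] y) (𝓝 (quadLHS (q : ℂ) a z y)) := by
  have hq : ‖(q : ℂ)‖ < 1 := by rwa [Complex.norm_of_nonneg hq0.le]
  have hp := norm_sq_lt_one hq
  obtain ⟨hz1, hza⟩ := lt_min_iff.1 hz
  have hx : ‖-z / a ^ 2‖ < 1 := by
    rw [norm_div, norm_neg, norm_pow]
    exact (div_lt_one ((norm_nonneg z).trans_lt hza)).2 hza
  refine ⟨summable_qHypTerm _ _ hq hx,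
    (qPochInf_ne_zero_iff _ hq).2 (mul_pow_ne_one_of_norm_lt_one hx hq),
    fun hB hy4 => ⟨summable_qHypTerm _ _ hp hz1, quadLHS_eq_quadRHS hq hz1 hza hy hy4 hB⟩, ?_⟩
  have hcont : ContinuousAt (fun w => quadLHS (q : ℂ) a z w) y := continuousAt_qHyp_param hq hx hy
  refine (tendsto_congr' ?_).1 (hcont.tendsto.mono_left nhdsWithin_le_nhds)
  filter_upwards [eventually_qPochInf_comp_ne_zero hq (f := fun w => (q : ℂ) * w ^ 2)
      (by fun_prop) (by simp) y,
    eventually_qPochInf_comp_ne_zero hp (f := fun w => (q : ℂ) ^ 2 * w ^ 4)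
      (by fun_prop) (by simp) y,
    eventually_qPochInf_comp_ne_zero hp (f := fun w => (q : ℂ) * z * w ^ 2 / a ^ 2)
      (by fun_prop) (by simp) y] with w h1 h2 h3
  exact quadLHS_eq_quadRHS hq hz1 hza h1 h2 h3
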